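/- Let $K$ be a dyadic local field, that is, a non-archimedean local field of characteristic $0$ whose residue field has characteristic $2$ (equivalently, the completion of a number field at a prime above $2$). Let $\mathfrak o$ be its ring of integers and $\pi$ a prime element of $\mathfrak o$. Let $(V,Q)$ be a nondegenerate quadratic space over $K$ with bilinear form $B(x,y)=\tfrac12\bigl(Q(x+y)-Q(x)-Q(y)\bigr)$, and let $L\subset V$ be a finitely generated $\mathfrak o$-submodule with $KL=V$ (an $\mathfrak o$-lattice) of rank $3$. Assume that $L$ is unimodular, i.e. $L=\{x\in V: B(x,y)\in\mathfrak o \text{ for all } y\in L\}$. Put $Q(L)=\{Q(x):x\in L\}$; let $\mathfrak s(L)$ be the fractional ideal generated by all $B(x,y)$ with $x,y\in L$; let $\mathfrak g(L)=Q(L)+2\mathfrak s(L)$ (an additive subgroup of $K$); let $\mathfrak m(L)$ be the largest fractional ideal contained in $\mathfrak g(L)$; and let $\mathfrak w(L)=\pi\,\mathfrak m(L)+2\,\mathfrak s(L)$ be the weight of $L$. Then $L$ is universal, i.e. $Q(L)=\mathfrak o$, if and only if $\mathfrak w(L)=(\pi)$ and $V$ is isotropic, i.e. there is a nonzero $x\in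 V$ with $Q(x)=0$. -/

import Mathlib

open scoped ValuativeRel

noncomputable section

namespace QuadLattice

variable {K : Type*} [Field K] {V : Type*} [AddCommGroup V] [Module K V]

/-- The symmetric bilinear form `B(x, y) = (Q(x + y) - Q(x) - Q(y)) / 2` of a quadratic space
over a field of characteristic different from `2`. -/
def bilin (Q : QuadraticForm K V) : LinearMap.BilinForm K V :=
  (2⁻¹ : K) • QuadraticMap.polarBilin Q

theorem bilin_apply (Q : QuadraticForm K V) (x y : V) :
    bilin Q x y = (Q (x + y) - Q x - Q y) / 2 := by
  simp [bilin, QuadraticMap.polar, div_eq_inv_mul]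

variable [ValuativeRel K]

/-- A lattice on the quadratic space `(V, Q)`: a finitely generated `𝒪[K]`-submodule `L` of `V`
with `K L = V`, where the space `V = K L` is nondegenerate. -/
structure IsQuadLattice (Q : QuadraticForm K V) (L : Submodule 𝒪[K] V) : Prop where
  isLattice : Submodule.IsLattice K L
  nondegenerate : (bilin Q).Nondegenerate

/-- The lattice `L` is unimodular: it coincides with its dual lattice
`{x ∈ V | B(x, y) ∈ 𝒪[K] for all y ∈ L}`. For a nonzero lattice on a nondegenerate space this says
that its scale and its volume are both the unit ideal. -/
def IsUnimodular (Q : QuadraticForm K V) (L : Submodule 𝒪[K] V) : Prop :=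
  LinearMap.BilinForm.dualSubmodule (bilin Q) L = L

/-- The lattice `L` is universal: `Q(L) = 𝒪[K]`. -/
def IsUniversal (Q : QuadraticForm K V) (L : Submodule 𝒪[K] V) : Prop :=
  Q '' (L : Set V) = (𝒪[K] : Set K)

/-- The space `(V, Q)` is isotropic: some nonzero vector has `Q x = 0`. -/
def IsIsotropic (Q : QuadraticForm K V) : Prop :=
  ∃ x : V, x ≠ 0 ∧ Q x = 0

/-- The scale `𝔰(L)`: the fractional ideal generated by all `B(x, y)` with `x, y ∈ L`. -/
def scale (Q : QuadraticForm K V) (L : Submodule 𝒪[K] V) : Submodule 𝒪[K] K :=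
  Submodule.span 𝒪[K] {a : K | ∃ x ∈ L, ∃ y ∈ L, bilin Q x y = a}

section CharZero

variable [CharZero K]

/-- The norm group `𝔤(L) = Q(L) + 2𝔰(L)`, an additive subgroup of `K`. -/
def normGroup (Q : QuadraticForm K V) (L : Submodule 𝒪[K] V) : AddSubgroup K where
  carrier := {a : K | ∃ x ∈ L, ∃ s ∈ scale Q L, a = Q x + 2 * s}
  zero_mem' := ⟨0, L.zero_mem, 0, Submodule.zero_mem _, by simp⟩
  add_mem' := by
    rintro _ _ ⟨x, hx, s, hs, rfl⟩ ⟨y, hy, t, ht, rfl⟩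
    refine ⟨x + y, L.add_mem hx hy, s + t - bilin Q x y, Submodule.sub_mem _
      (Submodule.add_mem _ hs ht) (Submodule.subset_span ⟨x, hx, y, hy, rfl⟩), ?_⟩
    rw [bilin_apply]
    ring
  neg_mem' := by
    rintro _ ⟨x, hx, s, hs, rfl⟩
    refine ⟨x, hx, -s - bilin Q x x, Submodule.sub_mem _ (Submodule.neg_mem _ hs)
      (Submodule.subset_span ⟨x, hx, x, hx, rfl⟩), ?_⟩
    have h : Q (x + x) = 4 * Q x := by
      rw [← two_smul K x, QuadraticMap.map_smul, smul_eq_mul]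
      ring
    rw [bilin_apply, h]
    ring

/-- The ideal `𝔪(L)`: the largest fractional ideal contained in `𝔤(L)`, written out as the set of
all `a` with `𝒪[K] a ⊆ 𝔤(L)`. See `isGreatest_normIdeal`. -/
def normIdeal (Q : QuadraticForm K V) (L : Submodule 𝒪[K] V) : Submodule 𝒪[K] K where
  carrier := {a : K | ∀ r : 𝒪[K], r • a ∈ normGroup Q L}
  zero_mem' := fun r => by
    rw [smul_zero]
    exact (normGroup Q L).zero_mem
  add_mem' := fun {a b} ha hb r => by
    rw [smul_add]
    exact (normGroup Q L).add_mem (ha r) (hb r)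
  smul_mem' := fun c a ha r => by
    rw [smul_smul]
    exact ha (r * c)

theorem isGreatest_normIdeal (Q : QuadraticForm K V) (L : Submodule 𝒪[K] V) :
    IsGreatest {I : Submodule 𝒪[K] K | (I : Set K) ⊆ (normGroup Q L : Set K)}
      (normIdeal Q L) := by
  constructor
  · intro a ha
    simpa using ha 1
  · intro I hI a ha r
    exact hI (I.smul_mem r ha)

/-- The weight `𝔴(L) = (π)𝔪(L) + 2𝔰(L)`, where `(π) = 𝓂[K]` is the maximal ideal of `𝒪[K]`. -/
def weight (Q : QuadraticForm K V) (L : Submodule 𝒪[K] V) : Submodule 𝒪[K] K :=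
  𝓂[K] • normIdeal Q L ⊔ Ideal.span {(2 : 𝒪[K])} • scale Q L

end CharZero

end QuadLattice

end

/-! If `L` is universal, its norm group contains `𝒪[K]`, which fixes the weight. Moreover `Q` is
surjective on `V`, so it represents minus its discriminant, and the complement of such a vector is a
hyperbolic plane. Conversely, an isotropic vector of a unimodular lattice, suitably scaled, lies in
a pair with `B(x, y) = 1`. This pair splits off, and `Q` becomes `2st + bt² + εu²` with `ε` a unit.
The weight condition puts `π` in the norm group, which allows a change of basis making `b` a prime
element. Then `εu²` corrects errors of even order and `πβt²` those of odd order, since residues are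
squares. The term `2st` absorbs what is left by precision `4`, so no limit is needed. -/

/-! ### Integral ternary forms `2st + bt² + εu²` -/

theorem ternary_represents_of_prime {R : Type*} [CommRing R] {π η : R} {e : ℕ}
    (h2 : (2 : R) = π ^ e * η) (hη : IsUnit η)
    (hloc : ∀ r : R, π ∣ r ∨ IsUnit r) (hsq : ∀ r : R, ∃ w, π ∣ r - w ^ 2)
    {β ε : R} (hβ : IsUnit β) (hε : IsUnit ε) (a : R) :
    ∃ s t u : R, 2 * s * t + π * β * t ^ 2 + ε * u ^ 2 = a := by
  by_contra hno
  obtain ⟨η', hη'⟩ := hη.exists_right_inv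
  obtain ⟨β', hβ'⟩ := hβ.exists_right_inv
  obtain ⟨ε', hε'⟩ := hε.exists_right_inv
  -- Approximation with `s = 0`. Subtraction is truncated, so `t` is constrained only for `i > e`;
  -- the constraint keeps the cross term `2t` divisible by `π ^ i`.
  have key : ∀ i ≤ 2 * e, ∃ t u : R, π ^ (i - e) ∣ t ∧
      π ^ i ∣ a - π * β * t ^ 2 - ε * u ^ 2 := by
    intro i
    induction i with
    | zero => exact fun _ => ⟨0, 0, by simp, by simp⟩
    | succ i ih =>
      intro hi
      obtain ⟨t, u, ht, ρ, hρ⟩ := ih (by omega)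
      have h2t : π ^ i ∣ 2 * t := by
        obtain ⟨τ, rfl⟩ := ht
        have : π ^ i ∣ π ^ e * π ^ (i - e) := by
          rw [← pow_add]; exact pow_dvd_pow _ (by omega)
        rw [h2, show π ^ e * η * (π ^ (i - e) * τ) = π ^ e * π ^ (i - e) * (η * τ) by ring]
        exact this.mul_right _
      have improve : ∃ t u : R, π ^ (i - e) ∣ t ∧
          π ^ (i + 1) ∣ a - π * β * t ^ 2 - ε * u ^ 2 := by
        rcases Nat.even_or_odd' i with ⟨m, rfl | rfl⟩
        · obtain ⟨w, hw⟩ := hsq (ε' * ρ)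
          refine ⟨t, u + π ^ m * w, ht, ?_⟩
          have h1 : π ^ (2 * m + 1) ∣ 2 * π ^ m := by
            rw [h2, mul_right_comm, ← pow_add]
            exact (pow_dvd_pow _ (by omega)).mul_right _
          have e1 : a - π * β * t ^ 2 - ε * (u + π ^ m * w) ^ 2 =
              π ^ (2 * m) * (ε * (ε' * ρ - w ^ 2)) - 2 * π ^ m * (ε * u * w) := by
            linear_combination hρ - π ^ (2 * m) * ρ * hε'
          rw [e1]
          refine dvd_sub ?_ (h1.mul_right _)
          rw [pow_succ]
          exact mul_dvd_mul_left _ (hw.mul_left _)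
        · obtain ⟨w, hw⟩ := hsq (β' * ρ)
          refine ⟨t + π ^ m * w, u, dvd_add ht ((pow_dvd_pow _ (by omega)).mul_right _), ?_⟩
          have e1 : a - π * β * (t + π ^ m * w) ^ 2 - ε * u ^ 2 =
              π ^ (2 * m + 1) * (β * (β' * ρ - w ^ 2)) - 2 * t * π * (β * π ^ m * w) := by
            linear_combination hρ - π ^ (2 * m + 1) * ρ * hβ'
          rw [e1]
          refine dvd_sub ?_ (Dvd.dvd.mul_right ?_ _)
          · rw [pow_succ]
            exact mul_dvd_mul_left _ (hw.mul_left _)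
          · rw [pow_succ]
            exact mul_dvd_mul_right h2t _
      obtain ⟨t, u, ⟨τ, rfl⟩, hr⟩ := improve
      refine ⟨_, u, ?_, hr⟩
      rcases Nat.lt_or_ge i e with h | h
      · rw [Nat.sub_eq_zero_of_le h]; simp
      rcases hloc τ with hτ | hτ
      · rw [Nat.sub_add_comm h, pow_succ]
        exact mul_dvd_mul_left _ hτ
      -- Here `2t` is a unit times `π ^ i`, so a suitable `s` absorbs the whole remaining error,
      -- against `hno`.
      obtain ⟨τ', hτ'⟩ := hτ.exists_right_inv
      obtain ⟨c, hc⟩ := hr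
      exfalso
      refine hno ⟨η' * τ' * π * c, π ^ (i - e) * τ, u, ?_⟩
      have hpow : π ^ e * π ^ (i - e) = π ^ i := by rw [← pow_add]; congr 1; omega
      rw [pow_succ π i, ← hpow] at hc
      rw [h2]
      linear_combination π ^ e * π ^ (i - e) * π * c * (τ * τ' * hη' + hτ') - hc
  obtain ⟨t, u, ⟨τ, rfl⟩, c, hc⟩ := key (2 * e) le_rfl
  -- The error and `πβt²` are now both divisible by `4`; with `t = 2` instead, the equation is
  -- linear in `s` with coefficient `4` and is solvable.
  refine hno ⟨η' ^ 2 * (c + π * β * τ ^ 2) - π * β, 2, u, ?_⟩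
  rw [show 2 * e - e = e by omega, two_mul, pow_add] at hc
  linear_combination (c + π * β * τ ^ 2) * (2 + π ^ e * η) * η' ^ 2 * h2 +
    (c + π * β * τ ^ 2) * π ^ e * π ^ e * (η * η' + 1) * hη' - hc

/-- Replacing `y` by `y + cz + kx` in the hyperbolic basis changes `b` to `b + c²ε + 2k`, which can
be made a unit times `π`. -/
theorem ternary_represents {R : Type*} [CommRing R] [IsDomain R] {π η : R} {e : ℕ}
    (hπ : Prime π) (h2 : (2 : R) = π ^ e * η) (hη : IsUnit η) (hπ2 : π ∣ 2)
    (hloc : ∀ r : R, π ∣ r ∨ IsUnit r) (hsq : ∀ r : R, ∃ w, π ∣ r - w ^ 2)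
    {b ε : R} (hε : IsUnit ε) (hg : ∃ s t u : R, 2 * s + b * t ^ 2 + ε * u ^ 2 = π) (a : R) :
    ∃ s t u : R, 2 * s * t + b * t ^ 2 + ε * u ^ 2 = a := by
  obtain ⟨ε', hε'⟩ := hε.exists_right_inv
  obtain ⟨η', hη'⟩ := hη.exists_right_inv
  suffices h : ∃ c k β : R, IsUnit β ∧ b + c ^ 2 * ε + 2 * k = π * β by
    obtain ⟨c, k, β, hβ, hb⟩ := h
    obtain ⟨s, t, u, h⟩ := ternary_represents_of_prime h2 hη hloc hsq hβ hε a
    exact ⟨s + k * t - ε * u * c, t, u + c * t, by linear_combination h + t ^ 2 * hb⟩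
  obtain ⟨c, d, hd⟩ := hsq (-(ε' * b))
  have hb : b + c ^ 2 * ε = π * (-(ε * d)) := by linear_combination b * -hε' - ε * hd
  by_cases hsq2 : π ^ 2 ∣ 2
  -- Modulo `π²` the term `2s` vanishes. If `b + c²ε` were also divisible by `π²`, then `hg` would
  -- force `π ∣ u - ct` and hence `π² ∣ π`.
  · refine ⟨c, 0, _, ?_, by rw [mul_zero, add_zero]; exact hb⟩
    obtain ⟨s, t, u, h⟩ := hg
    obtain ⟨q, hq⟩ := hsq2
    have hu : π ∣ u - c * t := by
      have : π ∣ ε * (u - c * t) ^ 2 := by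
        refine ⟨1 + ε * d * t ^ 2 - π * q * (s + ε * u * c * t - ε * c ^ 2 * t ^ 2), ?_⟩
        linear_combination h - t ^ 2 * hb - (s + ε * u * c * t - ε * c ^ 2 * t ^ 2) * hq
      rcases hπ.dvd_or_dvd this with h | h
      · exact absurd (isUnit_of_dvd_unit h hε) hπ.not_isUnit
      · exact hπ.dvd_of_dvd_pow h
    refine (hloc _).resolve_left fun hdvd => ?_
    obtain ⟨v, hv⟩ := hu
    obtain ⟨f, hf⟩ := hdvd
    refine hπ.not_isUnit (IsUnit.of_mul_eq_one
      (q * (s + ε * u * c * t - ε * c ^ 2 * t ^ 2) + ε * v ^ 2 + f * t ^ 2)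
      (mul_left_cancel₀ hπ.ne_zero ?_))
    linear_combination h - t ^ 2 * hb - (s + ε * u * c * t - ε * c ^ 2 * t ^ 2) * hq
      - ε * (u - c * t + π * v) * hv - π * t ^ 2 * hf
  -- Now `2` is itself a prime element, and `k` can turn `b + c²ε` into exactly `π`.
  · have he : e = 1 := by
      rcases e with _ | _ | e
      · rw [pow_zero, one_mul] at h2
        exact absurd (isUnit_of_dvd_unit (h2 ▸ hπ2) hη) hπ.not_isUnit
      · rfl
      · exact absurd (h2 ▸ (pow_dvd_pow _ (by omega)).mul_right _) hsq2
    rw [he, pow_one] at h2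
    exact ⟨c, η' * (1 + ε * d), 1, isUnit_one, by
      linear_combination hb + η' * (1 + ε * d) * h2 + π * (1 + ε * d) * hη'⟩

/-! ### Quadratic spaces over a field -/

namespace QuadLattice

theorem bilin_comm {K V : Type*} [Field K] [AddCommGroup V] [Module K V]
    (Q : QuadraticForm K V) (x y : V) : bilin Q x y = bilin Q y x := by
  rw [bilin_apply, bilin_apply, add_comm x y]; ring

theorem bilin_self {K V : Type*} [Field K] [CharZero K] [AddCommGroup V] [Module K V]
    (Q : QuadraticForm K V) (x : V) : bilin Q x x = Q x := by
  have h : Q (x + x) = 4 * Q x := by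
    rw [← two_smul K x, QuadraticMap.map_smul, smul_eq_mul]
    ring
  rw [bilin_apply, h]; ring

theorem map_hyperbolic_add {K V : Type*} [Field K] [CharZero K] [AddCommGroup V] [Module K V]
    {Q : QuadraticForm K V} {x y z : V} (hQx : Q x = 0) (hxy : bilin Q x y = 1)
    (hxz : bilin Q x z = 0) (hyz : bilin Q y z = 0) (s t u : K) :
    Q (s • x + t • y + u • z) = 2 * s * t + Q y * t ^ 2 + Q z * u ^ 2 := by
  rw [← bilin_self Q (_ + _)]
  simp only [map_add, map_smul, LinearMap.add_apply, LinearMap.smul_apply, smul_eq_mul,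
    bilin_self, hQx, hxy, hxz, hyz, bilin_comm Q y x, bilin_comm Q z x, bilin_comm Q z y]
  ring

/-- A nondegenerate ternary quadratic form is isotropic as soon as it represents the negative of
its discriminant. -/
theorem ternary_isotropic_of_represents {K : Type*} [Field K] {a b c x y z : K} (ha : a ≠ 0)
    (h : a * x ^ 2 + b * y ^ 2 + c * z ^ 2 = -(a * b * c)) :
    ∃ u v w : K, (u ≠ 0 ∨ v ≠ 0 ∨ w ≠ 0) ∧ a * u ^ 2 + b * v ^ 2 + c * w ^ 2 = 0 := by
  by_cases hz : z ^ 2 + a * b = 0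
  · have hxy : a * x ^ 2 + b * y ^ 2 = 0 := by linear_combination h - c * hz
    by_cases hx : x = 0
    · by_cases hy : y = 0
      · exact ⟨z, a, 0, Or.inr (Or.inl ha), by linear_combination a * hz⟩
      · exact ⟨x, y, 0, Or.inr (Or.inl hy), by linear_combination hxy⟩
    · exact ⟨x, y, 0, Or.inl hx, by linear_combination hxy⟩
  -- This vector is orthogonal to `(x, y, z)`. The identity `a(xz + by)² + b(yz - ax)² = (z² +
  -- ab)(ax² + by²)` shows it is isotropic.
  · exact ⟨x * z + b * y, y * z - a * x, z ^ 2 + a * b, Or.inr (Or.inr hz), by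
      linear_combination (z ^ 2 + a * b) * h⟩

theorem isIsotropic_of_surjective {K V : Type*} [Field K] [CharZero K] [AddCommGroup V]
    [Module K V] (Q : QuadraticForm K V) (hQ : (bilin Q).Nondegenerate)
    (hV : Module.finrank K V = 3) (hsurj : Function.Surjective Q) : IsIsotropic Q := by
  have : FiniteDimensional K V := FiniteDimensional.of_finrank_pos (by omega)
  let _ : Invertible (2 : K) := invertibleOfNonzero two_ne_zero
  have hsep : (QuadraticMap.associated (R := K) Q).SeparatingLeft := by
    intro x hx
    refine hQ.1 x fun y => ?_
    rw [bilin_apply, ← hx y, QuadraticMap.associated_apply,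
      Module.End.smul_def, QuadraticMap.half_moduleEnd_apply_eq_half_smul, smul_eq_mul, invOf_eq_inv, div_eq_inv_mul]
  obtain ⟨w, ⟨e⟩⟩ : ∃ w : Fin 3 → Kˣ,
      QuadraticMap.Equivalent Q (QuadraticMap.weightedSumSquares K w) :=
    hV ▸ Q.equivalent_weightedSumSquares_units_of_nondegenerate' hsep
  have hform (v : Fin 3 → K) : QuadraticMap.weightedSumSquares K w v =
      w 0 * v 0 ^ 2 + w 1 * v 1 ^ 2 + w 2 * v 2 ^ 2 := by
    simp [QuadraticMap.weightedSumSquares_apply, Fin.sum_univ_three, Units.smul_def, sq]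
  obtain ⟨v, hv⟩ := hsurj (-(w 0 * w 1 * w 2))
  rw [← e.map_app, hform] at hv
  obtain ⟨p, q, r, hne, h0⟩ := ternary_isotropic_of_represents (w 0).ne_zero hv
  refine ⟨e.symm ![p, q, r], fun h => ?_, ?_⟩
  · have h' : ![p, q, r] = 0 := by simpa using h
    have := congrFun h' 0
    have := congrFun h' 1
    have := congrFun h' 2
    simp_all
  · rw [e.symm.map_app, hform]
    simpa using h0

/-! ### Unimodular lattices over the ring of integers -/

section LocalField

variable {K : Type*} [Field K] [ValuativeRel K] {V : Type*} [AddCommGroup V] [Module K V]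
  {Q : QuadraticForm K V} {L : Submodule 𝒪[K] V}

theorem smul_def' (r : 𝒪[K]) (v : V) : r • v = (r : K) • v := rfl

theorem coe_two : ((2 : 𝒪[K]) : K) = 2 := rfl

theorem mem_iff_of_isUnimodular (h : IsUnimodular Q L) {x : V} :
    x ∈ L ↔ ∀ y ∈ L, ∃ r : 𝒪[K], (r : K) = bilin Q x y := by
  conv_lhs => rw [← h]
  simp only [LinearMap.BilinForm.mem_dualSubmodule, Submodule.mem_one]
  rfl

theorem scale_le_one (h : IsUnimodular Q L) : scale Q L ≤ 1 := by
  refine Submodule.span_le.2 ?_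
  rintro _ ⟨x, hx, y, hy, rfl⟩
  exact Submodule.mem_one.2 ((mem_iff_of_isUnimodular h).1 hx y hy)

theorem exists_coe_eq_apply [CharZero K] (h : IsUnimodular Q L) {x : V} (hx : x ∈ L) :
    ∃ r : 𝒪[K], (r : K) = Q x := by
  rw [← bilin_self]
  exact (mem_iff_of_isUnimodular h).1 hx x hx

theorem eq_zero_of_bilin_eq_zero (hL : IsQuadLattice Q L) {x : V}
    (hx : ∀ y ∈ L, bilin Q x y = 0) : x = 0 := by
  refine hL.nondegenerate.1 x fun y => ?_
  have hy : y ∈ Submodule.span K (L : Set V) := by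
    rw [hL.isLattice.span_eq_top]; trivial
  exact (Submodule.span_le (p := LinearMap.ker (bilin Q x))).2 hx hy

/-- Since `n / d = nd / d²`, scaling by `d⁻¹` reduces to integral values. -/
theorem surjective_of_isUniversal (h : IsUniversal Q L) : Function.Surjective Q := by
  intro a
  obtain ⟨n, d, hd, rfl⟩ := IsFractionRing.div_surjective (A := 𝒪[K]) a
  have hd0 : (d : K) ≠ 0 := by simpa using nonZeroDivisors.ne_zero hd
  obtain ⟨x, -, hx⟩ : ((n * d : 𝒪[K]) : K) ∈ Q '' (L : Set V) := by
    rw [h]; exact (n * d).2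
  refine ⟨(d : K)⁻¹ • x, ?_⟩
  rw [QuadraticMap.map_smul, hx, smul_eq_mul]
  change _ = (n : K) / (d : K)
  push_cast
  field_simp

/-- Both summands of the weight lie in the norm group. -/
theorem mem_normGroup_of_weight_eq [CharZero K] {π : 𝒪[K]}
    (h : weight Q L = Submodule.span 𝒪[K] {(π : K)}) : (π : K) ∈ normGroup Q L := by
  have hπ : (π : K) ∈ weight Q L := h ▸ Submodule.mem_span_singleton_self _
  obtain ⟨a, ha, b, hb, hab⟩ := Submodule.mem_sup.1 hπ
  rw [← hab]
  refine (normGroup Q L).add_mem ?_ ?_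
  · exact (isGreatest_normIdeal Q L).1 (Submodule.smul_le_right ha)
  · rw [Submodule.ideal_span_singleton_smul] at hb
    obtain ⟨s, hs, rfl⟩ := hb
    exact ⟨0, L.zero_mem, s, hs, by simp [smul_def', coe_two]⟩

/-- The vector `Q(z)⁻¹z` pairs integrally with `L`, so it lies in `L` by self-duality; pairing it
with `z` gives `1` as a multiple of `Q(z)`. -/
theorem exists_isUnit_of_orthogonal_complement [CharZero K] (hL : IsQuadLattice Q L)
    (hunim : IsUnimodular Q L) {x y z : V} (hz : z ∈ L) (hxz : bilin Q x z = 0)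
    (hyz : bilin Q y z = 0) (hz0 : z ≠ 0)
    (hspan : ∀ l ∈ L, ∃ s t u : 𝒪[K], s • x + t • y + u • z = l) :
    ∃ ε : 𝒪[K], IsUnit ε ∧ (ε : K) = Q z := by
  obtain ⟨ε, hε⟩ := exists_coe_eq_apply hunim hz
  have hzl (s t u : 𝒪[K]) : bilin Q z (s • x + t • y + u • z) = u * ε := by
    simp only [smul_def', map_add, map_smul, smul_eq_mul, bilin_self, bilin_comm Q z x,
      bilin_comm Q z y, hxz, hyz, hε]
    ring
  have hε0 : (ε : K) ≠ 0 := by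
    intro h0
    refine hz0 (eq_zero_of_bilin_eq_zero hL fun l hl => ?_)
    obtain ⟨s, t, u, rfl⟩ := hspan l hl
    rw [hzl, h0, mul_zero]
  have hmem : (ε : K)⁻¹ • z ∈ L := by
    refine (mem_iff_of_isUnimodular hunim).2 fun l hl => ?_
    obtain ⟨s, t, u, rfl⟩ := hspan l hl
    refine ⟨u, ?_⟩
    rw [map_smul, LinearMap.smul_apply, hzl, smul_eq_mul]
    field_simp
  obtain ⟨s, t, u, h⟩ := hspan _ hmem
  have h1 := hzl s t u
  rw [h, map_smul, bilin_self, ← hε, smul_eq_mul, inv_mul_cancel₀ hε0] at h1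
  exact ⟨ε, IsUnit.of_mul_eq_one_right u (Subtype.ext h1.symm), hε⟩

/-! ### Hyperbolic splitting and the two implications -/

variable [TopologicalSpace K] [IsNonarchimedeanLocalField K]

theorem finrank_eq_of_isQuadLattice (hL : IsQuadLattice Q L) :
    Module.finrank 𝒪[K] L = Module.finrank K V := by
  have := hL.isLattice
  exact congrArg Cardinal.toNat (Submodule.IsLattice.rank' K L)

/-- A unimodular lattice on an isotropic space has a primitive isotropic vector, which is part of
a hyperbolic pair. -/
theorem exists_isotropic_pair (hL : IsQuadLattice Q L) (hunim : IsUnimodular Q L)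
    (hiso : IsIsotropic Q) : ∃ x ∈ L, ∃ y ∈ L, Q x = 0 ∧ bilin Q x y = 1 := by
  obtain ⟨x, hx, hQx⟩ := hiso
  let I : Submodule 𝒪[K] K := L.map ((bilin Q x).restrictScalars 𝒪[K])
  have hI : IsFractional (nonZeroDivisors 𝒪[K]) I :=
    FractionalIdeal.isFractional_of_fg (hL.isLattice.fg.map _)
  -- With `B(x, L)` generated by `a`, the vector `a⁻¹x` pairs integrally with `L`, hence lies in it,
  -- and takes the value `1`.
  obtain ⟨a, ha⟩ := (FractionalIdeal.isPrincipal (⟨I, hI⟩ :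
    FractionalIdeal (nonZeroDivisors 𝒪[K]) K)).principal
  change I = _ at ha
  have ha0 : a ≠ 0 := by
    rintro rfl
    refine hx (eq_zero_of_bilin_eq_zero hL fun y hy => ?_)
    have : bilin Q x y ∈ I := ⟨y, hy, rfl⟩
    simpa [ha] using this
  obtain ⟨y, hy, hxy⟩ : a ∈ I := ha ▸ Submodule.mem_span_singleton_self a
  change bilin Q x y = a at hxy
  refine ⟨a⁻¹ • x, (mem_iff_of_isUnimodular hunim).2 fun l hl => ?_, y, hy, ?_, ?_⟩
  · have : bilin Q x l ∈ I := ⟨l, hl, rfl⟩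
    rw [ha, Submodule.mem_span_singleton] at this
    obtain ⟨r, hr⟩ := this
    refine ⟨r, ?_⟩
    rw [map_smul, LinearMap.smul_apply, ← hr, smul_def', smul_eq_mul, smul_eq_mul]
    field_simp
  · rw [QuadraticMap.map_smul, hQx, smul_zero]
  · rw [map_smul, LinearMap.smul_apply, hxy, smul_eq_mul, inv_mul_cancel₀ ha0]

variable [CharZero K]

theorem weight_eq_of_isUniversal {π : 𝒪[K]} (hπ : Irreducible π) (h2 : π ∣ 2)
    (hunim : IsUnimodular Q L) (h : IsUniversal Q L) :
    weight Q L = Submodule.span 𝒪[K] {(π : K)} := by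
  have hscale := scale_le_one hunim
  apply le_antisymm
  · refine sup_le (Submodule.smul_le.2 fun r hr a ha => ?_) (Submodule.smul_le.2 fun r hr a ha => ?_)
    · rw [hπ.maximalIdeal_eq, Ideal.mem_span_singleton] at hr
      obtain ⟨c, rfl⟩ := hr
      obtain ⟨x, hx, s, hs, hxs⟩ := by simpa using ha 1
      obtain ⟨p, hp⟩ := exists_coe_eq_apply hunim hx
      obtain ⟨q, hq⟩ := Submodule.mem_one.1 (hscale hs)
      refine Submodule.mem_span_singleton.2 ⟨c * (p + 2 * q), ?_⟩
      rw [hxs, ← hp, ← hq]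
      simp only [smul_def', smul_eq_mul, Subring.coe_mul, Subring.coe_add, coe_two]
      change _ = (π : K) * c * (p + 2 * (q : K))
      ring
    · obtain ⟨c, rfl⟩ := h2.trans (Ideal.mem_span_singleton.1 hr)
      obtain ⟨q, rfl⟩ := Submodule.mem_one.1 (hscale ha)
      refine Submodule.mem_span_singleton.2 ⟨c * q, ?_⟩
      simp only [smul_def', smul_eq_mul, Subring.coe_mul]
      change _ = (π : K) * c * (q : K)
      ring
  · rw [Submodule.span_singleton_le_iff_mem]
    have h1 : (1 : K) ∈ normIdeal Q L := by
      intro r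
      obtain ⟨x, hx, hxr⟩ : (r : K) ∈ Q '' (L : Set V) := by rw [h]; exact r.2
      exact ⟨x, hx, 0, Submodule.zero_mem _, by simp [smul_def', hxr]⟩
    have := Submodule.smul_mem_smul
      (show π ∈ 𝓂[K] by rw [hπ.maximalIdeal_eq]; exact Ideal.mem_span_singleton_self π) h1
    rw [smul_def', smul_eq_mul, mul_one] at this
    exact Submodule.mem_sup_left this

/-- A hyperbolic pair splits a ternary unimodular lattice. -/
theorem exists_orthogonal_complement (hL : IsQuadLattice Q L)
    (hrank : Module.finrank 𝒪[K] L = 3) (hunim : IsUnimodular Q L) {x y : V}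
    (hx : x ∈ L) (hy : y ∈ L) (hQx : Q x = 0) (hxy : bilin Q x y = 1) :
    ∃ z ∈ L, z ≠ 0 ∧ bilin Q x z = 0 ∧ bilin Q y z = 0 ∧
      ∀ l ∈ L, ∃ s t u : 𝒪[K], s • x + t • y + u • z = l := by
  let N : Submodule 𝒪[K] V := L ⊓ (LinearMap.ker (bilin Q x)).restrictScalars 𝒪[K] ⊓
    (LinearMap.ker (bilin Q y)).restrictScalars 𝒪[K]
  have hN {n : V} : n ∈ N ↔ n ∈ L ∧ bilin Q x n = 0 ∧ bilin Q y n = 0 := by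
    simp [N, and_assoc]
  have hxx : bilin Q x x = 0 := by rw [bilin_self, hQx]
  have hyx : bilin Q y x = 1 := by rw [bilin_comm, hxy]
  let ψ : (𝒪[K] × 𝒪[K]) × N →ₗ[𝒪[K]] V :=
    ((LinearMap.toSpanSingleton 𝒪[K] V x).coprod (LinearMap.toSpanSingleton 𝒪[K] V y)).coprod
      N.subtype
  have hψ (p) : ψ p = (p.1.1 : K) • x + (p.1.2 : K) • y + (p.2 : V) := rfl
  have hinj : Function.Injective ψ := by
    rw [← LinearMap.ker_eq_bot, LinearMap.ker_eq_bot']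
    rintro ⟨⟨s, t⟩, n, hn⟩ h
    obtain ⟨-, hxn, hyn⟩ := hN.1 hn
    rw [hψ] at h
    dsimp only at h
    have h1 : bilin Q x ((s : K) • x + (t : K) • y + n) = 0 := by rw [h, map_zero]
    have h2 : bilin Q y ((s : K) • x + (t : K) • y + n) = 0 := by rw [h, map_zero]
    simp only [map_add, map_smul, smul_eq_mul, hxx, hxy, hxn, hyn, hyx] at h1 h2
    have ht : (t : K) = 0 := by linear_combination h1
    rw [ht] at h2 h
    have hs : (s : K) = 0 := by linear_combination h2
    rw [hs] at h
    ext <;> simp_all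
  have hrange : LinearMap.range ψ = L := by
    apply le_antisymm
    · rintro _ ⟨⟨⟨s, t⟩, n⟩, rfl⟩
      exact L.add_mem (L.add_mem (L.smul_mem s hx) (L.smul_mem t hy)) (hN.1 n.2).1
    · intro l hl
      obtain ⟨t, ht⟩ := (mem_iff_of_isUnimodular hunim).1 hx l hl
      obtain ⟨p, hp⟩ := (mem_iff_of_isUnimodular hunim).1 hy l hl
      obtain ⟨b, hb⟩ := (mem_iff_of_isUnimodular hunim).1 hy y hy
      -- The coefficients solve `B(x, l) = t` and `B(y, l) = s + tb`.
      refine ⟨((p - t * b, t), ⟨l - (p - t * b) • x - t • y, hN.2 ⟨?_, ?_, ?_⟩⟩), ?_⟩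
      · exact L.sub_mem (L.sub_mem hl (L.smul_mem _ hx)) (L.smul_mem _ hy)
      · simp only [smul_def', map_sub, map_smul, smul_eq_mul, hxx, hxy, ← ht]
        ring
      · simp only [smul_def', map_sub, map_smul, smul_eq_mul, hyx, ← hb, ← hp,
          AddSubgroupClass.coe_sub, Subring.coe_mul]
        ring
      · rw [hψ]
        simp only [smul_def']
        abel
  have hlat := hL.isLattice
  have hfin : Module.Finite 𝒪[K] L := Submodule.IsLattice.finite K L
  have htf : Module.IsTorsionFree 𝒪[K] V := Module.IsTorsionFree.trans_faithfulSMul 𝒪[K] K V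
  have hNL : N ≤ L := fun n hn => (hN.1 hn).1
  have hNfin : Module.Finite 𝒪[K] N :=
    Module.Finite.of_injective (Submodule.inclusion hNL) (Submodule.inclusion_injective hNL)
  -- Counting ranks in the splitting leaves `3 - 2 = 1` for the complement, so it has a single
  -- generator.
  have hN1 : Module.finrank 𝒪[K] N = 1 := by
    have h := (LinearEquiv.ofInjective ψ hinj).finrank_eq
    rw [hrange, hrank, Module.finrank_prod, Module.finrank_prod, Module.finrank_self] at h
    omega
  obtain ⟨⟨z, hz⟩, hz0, hspan⟩ := finrank_eq_one_iff'.1 hN1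
  refine ⟨z, (hN.1 hz).1, fun h => hz0 (Subtype.ext h), (hN.1 hz).2.1, (hN.1 hz).2.2, fun l hl => ?_⟩
  rw [← hrange] at hl
  obtain ⟨⟨⟨s, t⟩, n⟩, rfl⟩ := hl
  obtain ⟨u, rfl⟩ := hspan n
  exact ⟨s, t, u, rfl⟩

theorem isUniversal_of_isIsotropic [CharP 𝓀[K] 2] {π : 𝒪[K]} (hπ : Irreducible π) (hπ2 : π ∣ 2)
    (hL : IsQuadLattice Q L) (hrank : Module.finrank 𝒪[K] L = 3) (hunim : IsUnimodular Q L)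
    (hw : weight Q L = Submodule.span 𝒪[K] {(π : K)}) (hiso : IsIsotropic Q) :
    IsUniversal Q L := by
  obtain ⟨x, hx, y, hy, hQx, hxy⟩ := exists_isotropic_pair hL hunim hiso
  obtain ⟨z, hz, hz0, hxz, hyz, hspan⟩ :=
    exists_orthogonal_complement hL hrank hunim hx hy hQx hxy
  obtain ⟨ε, hε, hεz⟩ :=
    exists_isUnit_of_orthogonal_complement hL hunim hz hxz hyz hz0 hspan
  obtain ⟨b, hb⟩ := exists_coe_eq_apply hunim hy
  have hform := map_hyperbolic_add hQx hxy hxz hyz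
  obtain ⟨e, η, h2⟩ := IsDiscreteValuationRing.eq_unit_mul_pow_irreducible
    (two_ne_zero : (2 : 𝒪[K]) ≠ 0) hπ
  have hloc (r : 𝒪[K]) : π ∣ r ∨ IsUnit r := by
    rw [← Ideal.mem_span_singleton, ← hπ.maximalIdeal_eq, IsLocalRing.mem_maximalIdeal]
    exact (em (IsUnit r)).symm
  -- Squaring is surjective on a finite field of characteristic two.
  have hsq (r : 𝒪[K]) : ∃ w, π ∣ r - w ^ 2 := by
    obtain ⟨w, hw⟩ := FiniteField.isSquare_of_char_two (ringChar.eq 𝓀[K] 2)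
      (IsLocalRing.residue 𝒪[K] r)
    obtain ⟨w, rfl⟩ := IsLocalRing.residue_surjective w
    refine ⟨w, ?_⟩
    rw [← Ideal.mem_span_singleton, ← hπ.maximalIdeal_eq, ← IsLocalRing.residue_eq_zero_iff,
      map_sub, map_pow, hw, sq, sub_self]
  have hg : ∃ s t u : 𝒪[K], 2 * s + b * t ^ 2 + ε * u ^ 2 = π := by
    obtain ⟨l, hl, r, hr, h⟩ := mem_normGroup_of_weight_eq hw
    obtain ⟨s, t, u, rfl⟩ := hspan l hl
    obtain ⟨r, rfl⟩ := Submodule.mem_one.1 (scale_le_one hunim hr)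
    refine ⟨s * t + r, t, u, Subtype.ext ?_⟩
    rw [smul_def', smul_def', smul_def', hform, ← hb, ← hεz] at h
    rw [h]
    simp only [Subring.coe_mul, Subring.coe_add, Subring.coe_pow, coe_two]
    change _ = _ + 2 * (r : K)
    ring
  apply Set.Subset.antisymm
  · rintro _ ⟨l, hl, rfl⟩
    obtain ⟨r, hr⟩ := exists_coe_eq_apply hunim hl
    exact hr ▸ r.2
  · intro a ha
    obtain ⟨s, t, u, h⟩ := ternary_represents hπ.prime (h2.trans (mul_comm _ _)) η.isUnit hπ2
      hloc hsq hε hg ⟨a, ha⟩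
    refine ⟨s • x + t • y + u • z,
      L.add_mem (L.add_mem (L.smul_mem s hx) (L.smul_mem t hy)) (L.smul_mem u hz), ?_⟩
    rw [smul_def', smul_def', smul_def', hform, ← hb, ← hεz]
    exact congrArg Subtype.val h

end LocalField

end QuadLattice

/-- `K` is a dyadic local field: a non-archimedean local field of characteristic zero with residue
field of characteristic two; `π` is a prime element of its ring of integers. -/
theorem proposition2p14 {K : Type*} [Field K] [ValuativeRel K] [TopologicalSpace K]
    [IsNonarchimedeanLocalField K] [CharZero K] [CharP 𝓀[K] 2]
    (π : 𝒪[K]) (hπ : Irreducible π)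
    {V : Type*} [AddCommGroup V] [Module K V] (Q : QuadraticForm K V) (L : Submodule 𝒪[K] V)
    (hL : QuadLattice.IsQuadLattice Q L) (hrank : Module.finrank 𝒪[K] L = 3)
    (hunim : QuadLattice.IsUnimodular Q L) :
    QuadLattice.IsUniversal Q L ↔
      QuadLattice.weight Q L = Submodule.span 𝒪[K] {(π : K)} ∧ QuadLattice.IsIsotropic Q := by
  have hπ2 : π ∣ 2 := by
    rw [← Ideal.mem_span_singleton, ← hπ.maximalIdeal_eq, ← IsLocalRing.residue_eq_zero_iff,
      map_ofNat]
    exact CharTwo.two_eq_zero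
  refine ⟨fun h => ⟨QuadLattice.weight_eq_of_isUniversal hπ hπ2 hunim h, ?_⟩,
    fun h => QuadLattice.isUniversal_of_isIsotropic hπ hπ2 hL hrank hunim h.1 h.2⟩
  exact QuadLattice.isIsotropic_of_surjective Q hL.nondegenerate
    ((QuadLattice.finrank_eq_of_isQuadLattice hL).symm.trans hrank)
    (QuadLattice.surjective_of_isUniversal h)
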